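/- Let $d\ge 1$ be an integer, $\mu>-\tfrac12$ and $n\in\mathbb N_0$. On the infinite cone $$\mathbb V^{d+1}=\{(x,t)\in\mathbb R^d\times(0,\infty):\ \|x\|\le t\}$$ consider the weight $W_\mu(x,t)=(t^2-\|x\|^2)^{\mu-\frac12}e^{-t}$ and the inner product $$\langle f,g\rangle_\mu=b_\mu\int_{\mathbb V^{d+1}}f(x,t)\,g(x,t)\,W_\mu(x,t)\,dx\,dt ,$$ where $b_\mu$ is the constant with $\langle 1,1\rangle_\mu=1$. Let $\mathcal V_n(\mathbb V^{d+1},W_\mu)$ be the space of orthogonal polynomials of degree $n$, that is, of the real polynomials $u$ in the $d+1$ variables $(x,t)$ of total degree at most $n$ such that $\langle u,q\rangle_\mu=0$ for every real polynomial $q$ of total degree less than $n$. Then every $u\in\mathcal V_n(\mathbb V^{d+1},W_\mu)$ satisfies the differential equation $$\mathcal D_\mu u=-n\,u,$$ where $\mathcal D_\mu$ is the second order linear differential operator $$\mathcal D_\mu=t\,(\Delta_x+\partial_t^2)+2\langle x,\nabla_x\rangle\,\partial_t-\langle x,\nabla_x\rangle+(2\mu+d-t)\,\partial_t ,$$ and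 $\Delta_x$, $\nabla_x$ are the Laplace operator and the gradient in the variable $x\in\mathbb R^d$. -/

import Mathlib

noncomputable section

namespace LaguerreCone

open MeasureTheory MvPolynomial

/-- Real polynomials in the `d + 1` variables `(x, t)`: the variables `Sum.inl i` are
`x_1, …, x_d` and the variable `Sum.inr ()` is `t`. -/
abbrev Poly (d : ℕ) : Type := MvPolynomial (Fin d ⊕ Unit) ℝ

/-- Points `(x, t)` of `ℝ^d × ℝ`, with the Euclidean norm on the first factor. -/
abbrev Point (d : ℕ) : Type := EuclideanSpace ℝ (Fin d) × ℝ

/-- The value `f(x, t)` of a polynomial. -/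
def value {d : ℕ} (f : Poly d) (p : Point d) : ℝ :=
  MvPolynomial.eval (Sum.elim (fun i => p.1 i) (fun _ => p.2)) f

/-- The infinite solid cone `{(x, t) : ‖x‖ ≤ t, t > 0}`. -/
def cone (d : ℕ) : Set (Point d) := {p | ‖p.1‖ ≤ p.2 ∧ 0 < p.2}

/-- The weight `(t² - ‖x‖²)^(μ - 1/2) e^(-t)`. -/
def weight {d : ℕ} (μ : ℝ) (p : Point d) : ℝ :=
  (p.2 ^ 2 - ‖p.1‖ ^ 2) ^ (μ - 1 / 2) * Real.exp (-p.2)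

/-- The constant which normalizes the weight to have total mass one on the cone. -/
def normConst (d : ℕ) (μ : ℝ) : ℝ := (∫ p in cone d, weight μ p)⁻¹

/-- The inner product of two polynomials with respect to the normalized weight on the cone. -/
def innerProd {d : ℕ} (μ : ℝ) (f g : Poly d) : ℝ :=
  normConst d μ * ∫ p in cone d, value f p * value g p * weight μ p

/-- The space of orthogonal polynomials of degree `n`: polynomials of total degree at most `n`
that are orthogonal to all polynomials of total degree less than `n`. -/
def orthPoly (d : ℕ) (μ : ℝ) (n : ℕ) : Set (Poly d) :=
  {u | u.totalDegree ≤ n ∧ ∀ q : Poly d, q.totalDegree < n → innerProd μ u q = 0}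

/-- The partial derivative with respect to `x_i`. -/
def dx {d : ℕ} (i : Fin d) (u : Poly d) : Poly d := pderiv (Sum.inl i) u

/-- The partial derivative with respect to `t`. -/
def dt {d : ℕ} (u : Poly d) : Poly d := pderiv (Sum.inr ()) u

/-- The Laplace operator in the `x` variables. -/
def laplaceX {d : ℕ} (u : Poly d) : Poly d := ∑ i : Fin d, dx i (dx i u)

/-- The Euler operator `⟨x, ∇_x⟩` in the `x` variables. -/
def eulerX {d : ℕ} (u : Poly d) : Poly d := ∑ i : Fin d, X (Sum.inl i) * dx i u

/-- The operator
`t (Δ_x + ∂_t²) + 2 ⟨x, ∇_x⟩ ∂_t - ⟨x, ∇_x⟩ + (2 μ + d - t) ∂_t`. -/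
def coneOp {d : ℕ} (μ : ℝ) (u : Poly d) : Poly d :=
  X (Sum.inr ()) * (laplaceX u + dt (dt u)) + 2 * eulerX (dt u) - eulerX u
    + (C (2 * μ + (d : ℝ)) - X (Sum.inr ())) * dt u

end LaguerreCone

end

/-!
Write `W = (t² - ‖x‖²)^(μ - 1/2) e^(-t)` and `A = [[t I, x], [xᵀ, t]]`. The operator has the
divergence form `W⁻¹ div (W A ∇)`, so it is symmetric with respect to `W`, with
`∫ (D u) v W = -∫ ⟨A ∇u, ∇v⟩ W`. Since `W` may be unbounded at the boundary of the cone, this is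
not proved by integrating by parts. Instead, the columns of `A` are the vector fields generating
linear flows that preserve the cone: the last column `(x, t)` generates the dilations and the
column `t e_i + x_i e_t` generates the Lorentz boosts in the `(x_i, t)`-plane. Both multiply
`t² - ‖x‖²` and Lebesgue measure by constants (equal to one for boosts), so in the change of
variables formula the parameter of the flow enters the integrand only through a polynomial times
`e^(-t)`. Differentiating the formula at the identity (`ConeFlow.moment_mkDerivation`) gives
`moment_dilation` and `moment_boost`, and the algebraic identity `coneOp_mul_add_gradForm`
combines them into the symmetry `moment_coneOp_mul_comm`. The domination needed for the
differentiation is `integrableOn_rpow_mul_exp_cone`.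

The terms of the operator which do not lower the degree add up to minus the Euler operator of
all the variables, so `r = D u + n u` has degree less than `n` when `u` has degree at most `n`
(`totalDegree_coneOp_add_le`, for `n ≥ 1`). If `u` is orthogonal to all polynomials of degree
less than `n`, then so is `D u`, hence `r`, by symmetry. Thus `∫ r² W = 0`, and `r = 0` by
`eq_zero_of_moment_mul_self`.
-/

noncomputable section

namespace LaguerreCone

open MeasureTheory MvPolynomial Set

variable {d : ℕ}

/-! ### Evaluation of polynomials and integrability of the weight -/

theorem value_add (f g : Poly d) (p : Point d) : value (f + g) p = value f p + value g p :=
  map_add _ _ _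

theorem value_sub (f g : Poly d) (p : Point d) : value (f - g) p = value f p - value g p :=
  map_sub _ _ _

theorem value_mul (f g : Poly d) (p : Point d) : value (f * g) p = value f p * value g p :=
  map_mul _ _ _

theorem value_C (c : ℝ) (p : Point d) : value (C c) p = c := eval_C c

theorem value_X_inl (i : Fin d) (p : Point d) : value (X (Sum.inl i)) p = p.1 i := eval_X _

theorem value_X_inr (p : Point d) : value (X (Sum.inr ()) : Poly d) p = p.2 := eval_X _

theorem continuous_value (f : Poly d) : Continuous (value f) := by
  refine (MvPolynomial.continuous_eval f).comp (continuous_pi fun j => ?_)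
  rcases j with i | _
  · simp only [Sum.elim_inl]; fun_prop
  · simp only [Sum.elim_inr]; fun_prop

theorem measurableSet_cone (d : ℕ) : MeasurableSet (cone d) :=
  (measurableSet_le (f := fun p : Point d => ‖p.1‖) (by fun_prop) measurable_snd).inter
    (measurableSet_lt (g := fun p : Point d => p.2) measurable_const measurable_snd)

theorem sq_sub_norm_sq_nonneg {p : Point d} (hp : p ∈ cone d) : 0 ≤ p.2 ^ 2 - ‖p.1‖ ^ 2 :=
  sub_nonneg.2 (pow_le_pow_left₀ (norm_nonneg _) hp.1 2)

theorem weight_nonneg (μ : ℝ) {p : Point d} (hp : p ∈ cone d) : 0 ≤ weight μ p :=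
  mul_nonneg (Real.rpow_nonneg (sq_sub_norm_sq_nonneg hp) _) (Real.exp_pos _).le

theorem measurable_sq_sub_rpow (a : ℝ) :
    Measurable fun p : Point d => (p.2 ^ 2 - ‖p.1‖ ^ 2) ^ a := by fun_prop

/-- On the cone every coordinate is bounded by `t`, so a polynomial grows slower than any
exponential of `t`. -/
theorem exists_abs_value_le_exp (f : Poly d) :
    ∀ ε : ℝ, 0 < ε → ∃ K : ℝ, 0 ≤ K ∧ ∀ p ∈ cone d, |value f p| ≤ K * Real.exp (ε * p.2) := by
  induction f using MvPolynomial.induction_on with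
  | C c =>
    intro ε hε
    refine ⟨|c|, abs_nonneg _, fun p hp => ?_⟩
    rw [value_C]
    exact le_mul_of_one_le_right (abs_nonneg _) (Real.one_le_exp (mul_pos hε hp.2).le)
  | add f g hf hg =>
    intro ε hε
    obtain ⟨K, hK, hfK⟩ := hf ε hε
    obtain ⟨K', hK', hgK⟩ := hg ε hε
    refine ⟨K + K', add_nonneg hK hK', fun p hp => ?_⟩
    rw [value_add, add_mul]
    exact (abs_add_le _ _).trans (add_le_add (hfK p hp) (hgK p hp))
  | mul_X f j hf =>
    intro ε hε
    obtain ⟨K, hK, hfK⟩ := hf (ε / 2) (half_pos hε)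
    refine ⟨K * (2 / ε), by positivity, fun p hp => ?_⟩
    have hj : |value (X j) p| ≤ p.2 := by
      rcases j with i | _
      · rw [value_X_inl]
        exact (PiLp.norm_apply_le p.1 i).trans hp.1
      · rw [value_X_inr, abs_of_pos hp.2]
    have ht : p.2 ≤ 2 / ε * Real.exp (ε / 2 * p.2) := by
      have h := Real.add_one_le_exp (ε / 2 * p.2)
      rw [div_mul_eq_mul_div, le_div_iff₀ hε]
      nlinarith
    calc |value (f * X j) p| = |value f p| * |value (X j) p| := by rw [value_mul, abs_mul]
      _ ≤ (K * Real.exp (ε / 2 * p.2)) * (2 / ε * Real.exp (ε / 2 * p.2)) :=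
          mul_le_mul (hfK p hp) (hj.trans ht) (abs_nonneg _) (by positivity)
      _ = K * (2 / ε) * (Real.exp (ε / 2 * p.2) * Real.exp (ε / 2 * p.2)) := by ring
      _ = K * (2 / ε) * Real.exp (ε * p.2) := by rw [← Real.exp_add]; ring_nf

theorem measurePreserving_sub_norm (d : ℕ) :
    MeasurePreserving (fun p : Point d => (p.1, p.2 - ‖p.1‖)) := by
  refine (MeasurePreserving.id (volume : Measure (EuclideanSpace ℝ (Fin d)))).skew_product
    (g := fun x t => t - ‖x‖) (by fun_prop) (.of_forall fun x => ?_)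
  exact (measurePreserving_sub_right volume ‖x‖).map_eq

theorem integrableOn_rpow_mul_exp {a c : ℝ} (ha : -1 < a) (hc : 0 < c) :
    IntegrableOn (fun s : ℝ => s ^ a * Real.exp (-c * s)) (Ioi 0) := by
  simpa using integrableOn_rpow_mul_exp_neg_mul_rpow (p := 1) ha one_pos hc

theorem integrable_norm_rpow_mul_exp (hd : 1 ≤ d) {a c : ℝ} (ha : -1 < a) (hc : 0 < c) :
    Integrable fun x : EuclideanSpace ℝ (Fin d) => ‖x‖ ^ a * Real.exp (-c * ‖x‖) := by
  have : Nonempty (Fin d) := ⟨⟨0, hd⟩⟩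
  refine (integrable_fun_norm_addHaar (μ := (volume : Measure (EuclideanSpace ℝ (Fin d))))
    (f := fun r : ℝ => r ^ a * Real.exp (-c * r))).2 ?_
  have h := integrableOn_rpow_mul_exp (a := ((d - 1 : ℕ) : ℝ) + a) (c := c)
    (by have : (0 : ℝ) ≤ ((d - 1 : ℕ) : ℝ) := Nat.cast_nonneg _
        linarith) hc
  refine h.congr_fun (fun y hy => ?_) measurableSet_Ioi
  simp only [finrank_euclideanSpace, Fintype.card_fin, smul_eq_mul]
  rw [Real.rpow_add hy, Real.rpow_natCast, mul_assoc]

/-- For a nonpositive exponent, `(t² - ‖x‖²)^a ≤ (t - ‖x‖)^a ‖x‖^a`, and the right-hand side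
times the exponential is a product of integrable functions of `x` and of `t - ‖x‖`. -/
theorem integrableOn_rpow_mul_exp_cone_of_nonpos (hd : 1 ≤ d) {a c : ℝ} (ha : -1 < a)
    (ha0 : a ≤ 0) (hc : 0 < c) :
    IntegrableOn (fun p : Point d => (p.2 ^ 2 - ‖p.1‖ ^ 2) ^ a * Real.exp (-c * p.2))
      (cone d) := by
  have : Nonempty (Fin d) := ⟨⟨0, hd⟩⟩
  have hk : Integrable ((Ici (0 : ℝ)).indicator fun s : ℝ => s ^ a * Real.exp (-c * s)) := by
    rw [integrable_indicator_iff measurableSet_Ici, integrableOn_Ici_iff_integrableOn_Ioi]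
    exact integrableOn_rpow_mul_exp ha hc
  have hprod := (measurePreserving_sub_norm d).integrable_comp_of_integrable
    ((integrable_norm_rpow_mul_exp hd ha hc).mul_prod hk)
  refine Integrable.mono' hprod.integrableOn (by fun_prop) ?_
  -- The bound fails at `x = 0`, where the real power `‖x‖ ^ a` with `a < 0` is zero by convention.
  have hx : ∀ᵐ p : Point d, p.1 ≠ 0 :=
    Measure.quasiMeasurePreserving_fst.ae (Measure.ae_ne volume (0 : EuclideanSpace ℝ (Fin d)))
  rw [ae_restrict_iff' (measurableSet_cone d)]
  filter_upwards [hx] with p hp0 hp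
  have hr : 0 < ‖p.1‖ := norm_pos_iff.2 hp0
  have hs : 0 ≤ p.2 - ‖p.1‖ := sub_nonneg.2 hp.1
  rw [Real.norm_of_nonneg
    (mul_nonneg (Real.rpow_nonneg (sq_sub_norm_sq_nonneg hp) _) (Real.exp_pos _).le)]
  simp only [Function.comp_apply]
  rw [indicator_of_mem (show p.2 - ‖p.1‖ ∈ Ici (0 : ℝ) from hs)]
  have h1 : (p.2 ^ 2 - ‖p.1‖ ^ 2) ^ a ≤ ‖p.1‖ ^ a * (p.2 - ‖p.1‖) ^ a := by
    rw [show p.2 ^ 2 - ‖p.1‖ ^ 2 = (p.2 + ‖p.1‖) * (p.2 - ‖p.1‖) by ring,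
      Real.mul_rpow (by linarith) hs]
    exact mul_le_mul_of_nonneg_right
      (Real.rpow_le_rpow_of_nonpos hr (by linarith) ha0) (Real.rpow_nonneg hs _)
  calc (p.2 ^ 2 - ‖p.1‖ ^ 2) ^ a * Real.exp (-c * p.2)
      ≤ ‖p.1‖ ^ a * (p.2 - ‖p.1‖) ^ a * Real.exp (-c * p.2) :=
        mul_le_mul_of_nonneg_right h1 (Real.exp_pos _).le
    _ = ‖p.1‖ ^ a * (p.2 - ‖p.1‖) ^ a
          * (Real.exp (-c * ‖p.1‖) * Real.exp (-c * (p.2 - ‖p.1‖))) := by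
        rw [← Real.exp_add]; ring_nf
    _ = _ := by ring

theorem integrableOn_rpow_mul_exp_cone (hd : 1 ≤ d) {a c : ℝ} (ha : -1 < a) (hc : 0 < c) :
    IntegrableOn (fun p : Point d => (p.2 ^ 2 - ‖p.1‖ ^ 2) ^ a * Real.exp (-c * p.2))
      (cone d) := by
  rcases le_total a 0 with ha0 | ha0
  · exact integrableOn_rpow_mul_exp_cone_of_nonpos hd ha ha0 hc
  -- For `a ≥ 0` a natural power of `t²` absorbs `(t² - ‖x‖²)^a`; half the exponential is left.
  obtain ⟨m, hm⟩ := exists_nat_ge a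
  obtain ⟨K, hK, hbound⟩ :=
    exists_abs_value_le_exp (d := d) (1 + X (Sum.inr ()) ^ (2 * m)) (c / 2) (half_pos hc)
  have h0 := integrableOn_rpow_mul_exp_cone_of_nonpos (a := 0) hd (by norm_num) le_rfl
    (half_pos hc)
  refine Integrable.mono' (h0.const_mul K) (by fun_prop) ?_
  rw [ae_restrict_iff' (measurableSet_cone d)]
  refine .of_forall fun p hp => ?_
  have hq := sq_sub_norm_sq_nonneg hp
  rw [Real.norm_of_nonneg (mul_nonneg (Real.rpow_nonneg hq _) (Real.exp_pos _).le)]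
  have hpow : (p.2 ^ 2 - ‖p.1‖ ^ 2) ^ a ≤ 1 + p.2 ^ (2 * m) := by
    rcases le_total (p.2 ^ 2 - ‖p.1‖ ^ 2) 1 with h1 | h1
    · have h2 := Real.rpow_le_one hq h1 ha0
      have h3 : 0 ≤ p.2 ^ (2 * m) := pow_nonneg hp.2.le _
      linarith
    · have h2 := Real.rpow_le_rpow_of_exponent_le h1 hm
      rw [Real.rpow_natCast] at h2
      have h3 : (p.2 ^ 2 - ‖p.1‖ ^ 2) ^ m ≤ (p.2 ^ 2) ^ m :=
        pow_le_pow_left₀ hq (by nlinarith [sq_nonneg ‖p.1‖]) m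
      rw [pow_mul]
      linarith
  have hv : value (1 + X (Sum.inr ()) ^ (2 * m)) p = 1 + p.2 ^ (2 * m) := by
    simp [value]
  have hle := hpow.trans ((le_abs_self _).trans (hv ▸ hbound p hp))
  calc (p.2 ^ 2 - ‖p.1‖ ^ 2) ^ a * Real.exp (-c * p.2)
      ≤ K * Real.exp (c / 2 * p.2) * Real.exp (-c * p.2) :=
        mul_le_mul_of_nonneg_right hle (Real.exp_pos _).le
    _ = K * Real.exp (-(c / 2) * p.2) := by
        rw [mul_assoc, ← Real.exp_add]; ring_nf
    _ = _ := by rw [Real.rpow_zero, one_mul]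

theorem integrableOn_value_mul_weight (hd : 1 ≤ d) {μ : ℝ} (hμ : -(1 / 2 : ℝ) < μ) (f : Poly d) :
    IntegrableOn (fun p => value f p * weight μ p) (cone d) := by
  obtain ⟨K, hK, hbound⟩ := exists_abs_value_le_exp f (1 / 2) (by norm_num)
  refine Integrable.mono' ((integrableOn_rpow_mul_exp_cone (a := μ - 1 / 2) hd (by linarith)
    (one_half_pos (α := ℝ))).const_mul K) ?_ ?_
  · refine Measurable.aestronglyMeasurable ((continuous_value f).measurable.mul ?_)
    unfold weight
    fun_prop
  rw [ae_restrict_iff' (measurableSet_cone d)]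
  refine .of_forall fun p hp => ?_
  rw [norm_mul, Real.norm_eq_abs, Real.norm_of_nonneg (weight_nonneg μ hp), weight]
  calc |value f p| * ((p.2 ^ 2 - ‖p.1‖ ^ 2) ^ (μ - 1 / 2) * Real.exp (-p.2))
      ≤ K * Real.exp (1 / 2 * p.2) * ((p.2 ^ 2 - ‖p.1‖ ^ 2) ^ (μ - 1 / 2) * Real.exp (-p.2)) :=
        mul_le_mul_of_nonneg_right (hbound p hp) (weight_nonneg μ hp)
    _ = K * ((p.2 ^ 2 - ‖p.1‖ ^ 2) ^ (μ - 1 / 2)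
          * (Real.exp (1 / 2 * p.2) * Real.exp (-p.2))) := by ring
    _ = _ := by rw [← Real.exp_add]; ring_nf

/-! ### Linear flows on the cone -/

/-- The moment functional `f ↦ ∫ f W` on the cone, with the weight not normalized. -/
def moment (μ : ℝ) (f : Poly d) : ℝ := ∫ p in cone d, value f p * weight μ p

/-- The chain rule along a curve in `ℝ^d × ℝ` whose velocity is given by the polynomials `V`. -/
theorem hasDerivAt_value_comp (V : Fin d ⊕ Unit → Poly d) {γ : ℝ → Point d} {s : ℝ}
    (hγ : ∀ j, HasDerivAt (fun s => value (X j) (γ s)) (value (V j) (γ s)) s) (f : Poly d) :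
    HasDerivAt (fun s => value f (γ s)) (value (mkDerivation ℝ V f) (γ s)) s := by
  induction f using MvPolynomial.induction_on with
  | C c =>
    rw [derivation_C]
    simp only [value_C]
    simpa [value] using hasDerivAt_const s c
  | add f g hf hg =>
    rw [map_add]
    simp only [value_add]
    exact hf.add hg
  | mul_X f j hf =>
    rw [Derivation.leibniz, mkDerivation_X]
    simp only [value_add, value_mul, smul_eq_mul]
    convert! hf.mul (hγ j) using 1
    ring

/-- A family `T s` of linear maps of `ℝ^d × ℝ` moving along the polynomial vector field `V`,
which preserves the cone and scales both `t² - ‖x‖²` and Lebesgue measure by exponentials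
in `s`. -/
structure ConeFlow (d : ℕ) (V : Fin d ⊕ Unit → Poly d) (T : ℝ → Point d →ₗ[ℝ] Point d)
    (β δ : ℝ) : Prop where
  zero : T 0 = LinearMap.id
  mem_cone : ∀ s p, T s p ∈ cone d ↔ p ∈ cone d
  quad : ∀ s p, (T s p).2 ^ 2 - ‖(T s p).1‖ ^ 2 = Real.exp (β * s) * (p.2 ^ 2 - ‖p.1‖ ^ 2)
  abs_det : ∀ s, |LinearMap.det (T s)| = Real.exp (δ * s)
  exp_mul_le : ∀ s, ∀ p ∈ cone d, Real.exp (-|s|) * p.2 ≤ (T s p).2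
  deriv : ∀ p s j, HasDerivAt (fun s => value (X j) (T s p)) (value (V j) (T s p)) s

instance : (volume : Measure (Point d)).IsAddHaarMeasure :=
  Measure.prod.instIsAddHaarMeasure volume volume

theorem integral_comp_linearMap (f : Point d → ℝ) {T : Point d →ₗ[ℝ] Point d}
    (hT : LinearMap.det T ≠ 0) : ∫ p, f (T p) = |LinearMap.det T|⁻¹ * ∫ p, f p := by
  have h1 := Measure.map_linearMap_addHaar_eq_smul_addHaar (volume : Measure (Point d)) hT
  have h2 := integral_map_equiv (μ := (volume : Measure (Point d)))
    (T.equivOfDetNeZero hT).toContinuousLinearEquiv.toHomeomorph.toMeasurableEquiv f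
  have h3 : ⇑(T.equivOfDetNeZero hT).toContinuousLinearEquiv.toHomeomorph.toMeasurableEquiv
      = ⇑T := rfl
  rw [h3, h1, integral_smul_measure] at h2
  rw [← h2, ENNReal.toReal_ofReal (abs_nonneg _), abs_inv, smul_eq_mul]

namespace ConeFlow

variable {V : Fin d ⊕ Unit → Poly d} {T : ℝ → Point d →ₗ[ℝ] Point d} {β δ μ : ℝ}

/-- Change of variables: only the factor `e^(-t)` of the weight is transported nontrivially. -/
theorem integral_comp (h : ConeFlow d V T β δ) (μ : ℝ) (f : Poly d) (s : ℝ) :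
    ∫ p in cone d, value f (T s p) * Real.exp (-(T s p).2)
        * (p.2 ^ 2 - ‖p.1‖ ^ 2) ^ (μ - 1 / 2)
      = Real.exp (-(β * (μ - 1 / 2) + δ) * s) * moment μ f := by
  have hdet : LinearMap.det (T s) ≠ 0 := by
    rw [← abs_pos, h.abs_det]
    exact Real.exp_pos _
  have h1 := integral_comp_linearMap
    ((cone d).indicator fun p => value f p * weight μ p) hdet
  rw [integral_indicator (measurableSet_cone d), h.abs_det, ← Real.exp_neg] at h1
  have h2 : ∀ p : Point d, (cone d).indicator (fun p => value f (T s p)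
        * Real.exp (-(T s p).2) * (p.2 ^ 2 - ‖p.1‖ ^ 2) ^ (μ - 1 / 2)) p
      = Real.exp (-(β * (μ - 1 / 2)) * s)
        * (cone d).indicator (fun p => value f p * weight μ p) (T s p) := by
    intro p
    by_cases hp : p ∈ cone d
    · rw [indicator_of_mem hp, indicator_of_mem ((h.mem_cone s p).2 hp), weight, h.quad,
        Real.mul_rpow (Real.exp_pos _).le (sq_sub_norm_sq_nonneg hp), ← Real.exp_mul]
      have : Real.exp (-(β * (μ - 1 / 2)) * s) * Real.exp (β * s * (μ - 1 / 2)) = 1 := by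
        rw [← Real.exp_add, Real.exp_eq_one_iff]; ring
      linear_combination (-(value f (T s p) * Real.exp (-(T s p).2)
        * (p.2 ^ 2 - ‖p.1‖ ^ 2) ^ (μ - 1 / 2))) * this
    · rw [indicator_of_notMem hp, indicator_of_notMem (mt (h.mem_cone s p).1 hp), mul_zero]
  rw [← integral_indicator (measurableSet_cone d)]
  simp_rw [h2]
  rw [integral_const_mul, h1, ← mul_assoc, ← Real.exp_add, moment]
  ring_nf

/-- The infinitesimal form of the change of variables: differentiate under the integral sign
at `s = 0`. -/
theorem moment_mkDerivation (h : ConeFlow d V T β δ) (hd : 1 ≤ d) (hμ : -(1 / 2 : ℝ) < μ)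
    (f : Poly d) :
    moment μ (mkDerivation ℝ V f - V (Sum.inr ()) * f)
      = -(β * (μ - 1 / 2) + δ) * moment μ f := by
  set g : Poly d := mkDerivation ℝ V f - V (Sum.inr ()) * f with hg
  obtain ⟨K, hK, hbound⟩ := exists_abs_value_le_exp g (1 / 2) (by norm_num)
  have hT : ∀ s, Continuous (T s) := fun s => (T s).continuous_of_finiteDimensional
  have hmeas : ∀ (q : Poly d) (s : ℝ), AEStronglyMeasurable (fun p : Point d =>
      value q (T s p) * Real.exp (-(T s p).2) * (p.2 ^ 2 - ‖p.1‖ ^ 2) ^ (μ - 1 / 2))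
      (volume.restrict (cone d)) := fun q s =>
    (((((continuous_value q).comp (hT s)).mul
      (Real.continuous_exp.comp (continuous_snd.comp (hT s)).neg)).measurable).mul
      (measurable_sq_sub_rpow _)).aestronglyMeasurable
  have hderiv := (hasDerivAt_integral_of_dominated_loc_of_deriv_le
    (μ := volume.restrict (cone d)) (x₀ := (0 : ℝ)) (s := Metric.ball 0 1)
    (F := fun s p => value f (T s p) * Real.exp (-(T s p).2)
      * (p.2 ^ 2 - ‖p.1‖ ^ 2) ^ (μ - 1 / 2))
    (F' := fun s p => value g (T s p) * Real.exp (-(T s p).2)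
      * (p.2 ^ 2 - ‖p.1‖ ^ 2) ^ (μ - 1 / 2))
    (bound := fun p => K * ((p.2 ^ 2 - ‖p.1‖ ^ 2) ^ (μ - 1 / 2)
      * Real.exp (-(Real.exp (-1) / 2) * p.2)))
    (Metric.ball_mem_nhds _ one_pos) (.of_forall fun s => hmeas f s) ?_ (hmeas g 0) ?_
    ((integrableOn_rpow_mul_exp_cone hd (by linarith) (by positivity)).const_mul K) ?_).2
  · have hexp : HasDerivAt (fun s => Real.exp (-(β * (μ - 1 / 2) + δ) * s) * moment μ f)
        (-(β * (μ - 1 / 2) + δ) * moment μ f) 0 := by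
      have h1 := (((hasDerivAt_id (0 : ℝ)).const_mul (-(β * (μ - 1 / 2) + δ))).exp).mul_const
        (moment μ f)
      simpa using h1
    simp only [h.integral_comp] at hderiv
    rw [← hderiv.unique hexp]
    simp
  · refine (integrableOn_value_mul_weight hd hμ f).congr (.of_forall fun p => ?_)
    simp only [h.zero, LinearMap.id_apply, weight]
    ring
  · rw [ae_restrict_iff' (measurableSet_cone d)]
    refine .of_forall fun p hp s hs => ?_
    have hs1 : |s| ≤ 1 := by
      rw [Metric.mem_ball, dist_zero_right, Real.norm_eq_abs] at hs
      exact hs.le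
    have hq := Real.rpow_nonneg (sq_sub_norm_sq_nonneg hp) (μ - 1 / 2)
    have ht : Real.exp (-1) * p.2 ≤ (T s p).2 :=
      (mul_le_mul_of_nonneg_right (Real.exp_le_exp.2 (neg_le_neg hs1)) hp.2.le).trans
        (h.exp_mul_le s p hp)
    rw [norm_mul, norm_mul, Real.norm_eq_abs, Real.norm_of_nonneg (Real.exp_pos _).le,
      Real.norm_of_nonneg hq]
    calc |value g (T s p)| * Real.exp (-(T s p).2) * (p.2 ^ 2 - ‖p.1‖ ^ 2) ^ (μ - 1 / 2)
        ≤ K * Real.exp (1 / 2 * (T s p).2) * Real.exp (-(T s p).2)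
            * (p.2 ^ 2 - ‖p.1‖ ^ 2) ^ (μ - 1 / 2) :=
          mul_le_mul_of_nonneg_right (mul_le_mul_of_nonneg_right
            (hbound _ ((h.mem_cone s p).2 hp)) (Real.exp_pos _).le) hq
      _ = K * ((p.2 ^ 2 - ‖p.1‖ ^ 2) ^ (μ - 1 / 2) * Real.exp (-(1 / 2) * (T s p).2)) := by
          rw [mul_assoc K, ← Real.exp_add]; ring_nf
      _ ≤ _ := by
          refine mul_le_mul_of_nonneg_left (mul_le_mul_of_nonneg_left
            (Real.exp_le_exp.2 ?_) hq) hK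
          linarith
  · refine .of_forall fun p s _ => ?_
    have h1 := hasDerivAt_value_comp V (h.deriv p s) f
    have h2 : HasDerivAt (fun s => (T s p).2) (value (V (Sum.inr ())) (T s p)) s := by
      simpa only [value_X_inr] using h.deriv p s (Sum.inr ())
    have h3 : HasDerivAt (fun s => -(T s p).2) (-value (V (Sum.inr ())) (T s p)) s := h2.neg
    convert! (h1.mul h3.exp).mul_const ((p.2 ^ 2 - ‖p.1‖ ^ 2) ^ (μ - 1 / 2)) using 1
    rw [hg, value_sub, value_mul]
    ring

end ConeFlow

/-! ### Dilations and boosts -/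

theorem coneFlow_dilation (d : ℕ) :
    ConeFlow d X (fun s => Real.exp s • LinearMap.id) 2 (d + 1) where
  zero := by simp
  mem_cone s p := by
    simp [cone, norm_smul, abs_of_pos (Real.exp_pos s), mul_le_mul_iff_right₀ (Real.exp_pos s),
      Real.exp_pos s]
  quad s p := by
    simp only [LinearMap.smul_apply, LinearMap.id_apply, Prod.smul_fst, Prod.smul_snd, norm_smul,
      Real.norm_of_nonneg (Real.exp_pos s).le, smul_eq_mul]
    rw [mul_comm 2 s, Real.exp_mul, Real.rpow_two]
    ring
  abs_det s := by
    rw [LinearMap.det_smul, LinearMap.det_id, mul_one, abs_of_pos (pow_pos (Real.exp_pos s) _),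
      ← Real.exp_nat_mul]
    simp
  exp_mul_le s p hp := by
    simpa using mul_le_mul_of_nonneg_right (Real.exp_le_exp.2 (neg_abs_le s)) hp.2.le
  deriv p s j := by
    have h : ∀ s, value (X j) ((Real.exp s • (LinearMap.id : Point d →ₗ[ℝ] Point d)) p)
        = Real.exp s * value (X j) p := by
      intro s
      rcases j with i | _ <;> simp [value]
    simp only [h]
    exact (Real.hasDerivAt_exp s).mul_const _

/-- The linear map of the `(x_i, t)`-plane with matrix `[[c, σ], [σ, c]]`, extended by the
identity in the other coordinates. For `c = cosh s`, `σ = sinh s` it is the Lorentz boost. -/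
def boost (i : Fin d) (c σ : ℝ) : Point d →ₗ[ℝ] Point d where
  toFun p := (p.1 + ((c - 1) * p.1 i + σ * p.2) • EuclideanSpace.single i (1 : ℝ),
    σ * p.1 i + c * p.2)
  map_add' p q := by
    ext j
    · by_cases hj : j = i
      · simp [hj]
        ring
      · simp [hj]
    · simp
      ring
  map_smul' r p := by
    ext j
    · by_cases hj : j = i
      · simp [hj]
        ring
      · simp [hj]
    · simp
      ring

theorem boost_fst_self (i : Fin d) (c σ : ℝ) (p : Point d) :
    (boost i c σ p).1 i = c * p.1 i + σ * p.2 := by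
  simp [boost]
  ring

theorem boost_fst_of_ne {i j : Fin d} (hij : j ≠ i) (c σ : ℝ) (p : Point d) :
    (boost i c σ p).1 j = p.1 j := by
  simp [boost, hij]

theorem boost_snd (i : Fin d) (c σ : ℝ) (p : Point d) :
    (boost i c σ p).2 = σ * p.1 i + c * p.2 := rfl

theorem boost_boost (i : Fin d) (c σ c' σ' : ℝ) :
    boost i c σ ∘ₗ boost i c' σ' = boost i (c * c' + σ * σ') (c * σ' + σ * c') := by
  refine LinearMap.ext fun p => Prod.ext (PiLp.ext fun j => ?_) ?_
  · rw [LinearMap.comp_apply]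
    rcases eq_or_ne j i with rfl | hj
    · simp only [boost_fst_self, boost_snd]
      ring
    · simp only [boost_fst_of_ne hj]
  · rw [LinearMap.comp_apply]
    simp only [boost_fst_self, boost_snd]
    ring

theorem boost_one_zero (i : Fin d) : boost i 1 0 = LinearMap.id := by
  refine LinearMap.ext fun p => Prod.ext (PiLp.ext fun j => ?_) ?_
  · rcases eq_or_ne j i with rfl | hj
    · simp [boost_fst_self]
    · simp [boost_fst_of_ne hj]
  · simp [boost_snd]

/-- The inverse boost is conjugate to the boost by the reflection `t ↦ -t`, so both have the
same determinant, whose square is therefore one. -/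
theorem abs_det_boost (i : Fin d) {c σ : ℝ} (h : c ^ 2 - σ ^ 2 = 1) :
    |LinearMap.det (boost i c σ)| = 1 := by
  let S : Point d ≃ₗ[ℝ] Point d := (LinearEquiv.refl ℝ _).prodCongr (LinearEquiv.neg ℝ)
  have hconj : (S : Point d →ₗ[ℝ] Point d) ∘ₗ boost i c σ ∘ₗ (S.symm : Point d →ₗ[ℝ] Point d)
      = boost i c (-σ) := by
    refine LinearMap.ext fun p => Prod.ext (PiLp.ext fun j => ?_) ?_
    · simp [S, boost]
    · simp [S, boost]
      ring
  have hdet := LinearMap.det_conj (boost i c σ) S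
  rw [hconj] at hdet
  have hmul := congrArg LinearMap.det (boost_boost i c σ c (-σ))
  rw [show c * c + σ * -σ = 1 by linarith, show c * -σ + σ * c = 0 by ring, boost_one_zero,
    LinearMap.det_comp, LinearMap.det_id, hdet] at hmul
  rw [← pow_eq_one_iff_of_nonneg (abs_nonneg _) two_ne_zero, sq_abs, sq, hmul]

theorem boost_quad (i : Fin d) {c σ : ℝ} (h : c ^ 2 - σ ^ 2 = 1) (p : Point d) :
    (boost i c σ p).2 ^ 2 - ‖(boost i c σ p).1‖ ^ 2 = p.2 ^ 2 - ‖p.1‖ ^ 2 := by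
  rw [EuclideanSpace.real_norm_sq_eq, EuclideanSpace.real_norm_sq_eq,
    ← Finset.add_sum_erase _ _ (Finset.mem_univ i),
    ← Finset.add_sum_erase _ (fun j => p.1 j ^ 2) (Finset.mem_univ i),
    Finset.sum_congr rfl fun j hj => by rw [boost_fst_of_ne (Finset.ne_of_mem_erase hj)],
    boost_fst_self, boost_snd]
  linear_combination (p.2 ^ 2 - p.1 i ^ 2) * h

theorem exp_neg_abs_mul_le_boost_snd (i : Fin d) (s : ℝ) {p : Point d} (hp : p ∈ cone d) :
    Real.exp (-|s|) * p.2 ≤ (boost i (Real.cosh s) (Real.sinh s) p).2 := by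
  have hx : |p.1 i| ≤ p.2 := (PiLp.norm_apply_le p.1 i).trans hp.1
  have h1 : -(|Real.sinh s| * p.2) ≤ Real.sinh s * p.1 i := by
    refine neg_le.1 ((neg_le_abs _).trans ?_)
    rw [abs_mul]
    exact mul_le_mul_of_nonneg_left hx (abs_nonneg _)
  have h2 : Real.exp (-|s|) = Real.cosh s - |Real.sinh s| := by
    rw [Real.abs_sinh, ← Real.cosh_abs, Real.cosh_sub_sinh]
  rw [boost_snd, h2]
  linarith

theorem boost_mem_cone (i : Fin d) (s : ℝ) {p : Point d} (hp : p ∈ cone d) :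
    boost i (Real.cosh s) (Real.sinh s) p ∈ cone d := by
  have ht : 0 < (boost i (Real.cosh s) (Real.sinh s) p).2 :=
    (mul_pos (Real.exp_pos _) hp.2).trans_le (exp_neg_abs_mul_le_boost_snd i s hp)
  refine ⟨?_, ht⟩
  rw [← abs_of_pos ht, ← abs_norm, ← sq_le_sq, ← sub_nonneg,
    boost_quad i (Real.cosh_sq_sub_sinh_sq s)]
  exact sq_sub_norm_sq_nonneg hp

/-- The vector field `t ∂_i + x_i ∂_t` which generates the boosts in the `(x_i, t)`-plane. -/
def boostField (i : Fin d) : Fin d ⊕ Unit → Poly d :=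
  Pi.single (Sum.inl i) (X (Sum.inr ())) + Pi.single (Sum.inr ()) (X (Sum.inl i))

theorem coneFlow_boost (i : Fin d) :
    ConeFlow d (boostField i) (fun s => boost i (Real.cosh s) (Real.sinh s)) 0 0 where
  zero := by rw [Real.cosh_zero, Real.sinh_zero, boost_one_zero]
  mem_cone s p := by
    refine ⟨fun hp => ?_, boost_mem_cone i s⟩
    have h := boost_mem_cone i (-s) hp
    rw [← LinearMap.comp_apply, boost_boost, Real.cosh_neg, Real.sinh_neg] at h
    rw [show Real.cosh s * Real.cosh s + -Real.sinh s * Real.sinh s = 1 by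
        linarith [Real.cosh_sq_sub_sinh_sq s],
      show Real.cosh s * Real.sinh s + -Real.sinh s * Real.cosh s = 0 by ring,
      boost_one_zero] at h
    exact h
  quad s p := by
    rw [boost_quad i (Real.cosh_sq_sub_sinh_sq s), zero_mul, Real.exp_zero, one_mul]
  abs_det s := by
    rw [abs_det_boost i (Real.cosh_sq_sub_sinh_sq s), zero_mul, Real.exp_zero]
  exp_mul_le s p hp := exp_neg_abs_mul_le_boost_snd i s hp
  deriv p s j := by
    rcases j with j | _
    · rcases eq_or_ne j i with rfl | hj
      · have hV : boostField j (Sum.inl j) = X (Sum.inr ()) := by simp [boostField]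
        rw [hV]
        simp only [value_X_inl, value_X_inr, boost_fst_self, boost_snd]
        exact ((Real.hasDerivAt_cosh s).mul_const _).add ((Real.hasDerivAt_sinh s).mul_const _)
      · have hV : boostField i (Sum.inl j) = 0 := by simp [boostField, hj]
        rw [hV]
        simp only [value_X_inl, boost_fst_of_ne hj]
        simpa [value] using hasDerivAt_const s (p.1 j)
    · have hV : boostField i (Sum.inr ()) = X (Sum.inl i) := by simp [boostField]
      rw [hV]
      change HasDerivAt (fun s => value (X (Sum.inr ())) _) _ s
      simp only [value_X_inl, value_X_inr, boost_fst_self, boost_snd]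
      exact ((Real.hasDerivAt_sinh s).mul_const _).add ((Real.hasDerivAt_cosh s).mul_const _)

/-! ### Derivations of the polynomial ring -/

theorem sum_coordinates (F : Fin d ⊕ Unit → Poly d) :
    ∑ j, F j = ∑ i : Fin d, F (Sum.inl i) + F (Sum.inr ()) := by
  simp

theorem derivation_sum_apply {ι : Type*} (s : Finset ι)
    (D : ι → Derivation ℝ (Poly d) (Poly d)) (f : Poly d) :
    (∑ j ∈ s, D j) f = ∑ j ∈ s, D j f := by
  have h := congrFun (map_sum Derivation.coeFnAddMonoidHom D s) f
  rwa [Finset.sum_apply] at h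

theorem mkDerivation_eq_sum (V : Fin d ⊕ Unit → Poly d) (f : Poly d) :
    mkDerivation ℝ V f = ∑ j, V j * pderiv j f := by
  have h : mkDerivation ℝ V = ∑ j, V j • pderiv j := by
    refine derivation_ext fun k => ?_
    rw [mkDerivation_X, derivation_sum_apply, Finset.sum_eq_single k]
    · simp
    · intro j _ hj
      simp [pderiv_X_of_ne hj.symm]
    · simp
  rw [h, derivation_sum_apply]
  rfl

theorem pderiv_pderiv_comm {σ : Type*} (i j : σ) (f : MvPolynomial σ ℝ) :
    pderiv i (pderiv j f) = pderiv j (pderiv i f) := by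
  classical
  have h : ⁅pderiv (R := ℝ) i, pderiv (R := ℝ) j⁆ = 0 := by
    refine derivation_ext fun k => ?_
    rw [Derivation.commutator_apply, pderiv_X, pderiv_X, Pi.single_apply, Pi.single_apply]
    split_ifs <;> simp
  rw [← sub_eq_zero, ← Derivation.commutator_apply, h, Derivation.zero_apply]

/-! ### Infinitesimal invariance of the moment functional -/

section Moment

variable {μ : ℝ}

theorem moment_add (hd : 1 ≤ d) (hμ : -(1 / 2 : ℝ) < μ) (f g : Poly d) :
    moment μ (f + g) = moment μ f + moment μ g := by
  simp only [moment, value_add, add_mul]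
  exact integral_add (integrableOn_value_mul_weight hd hμ f) (integrableOn_value_mul_weight hd hμ g)

theorem moment_C_mul (μ c : ℝ) (f : Poly d) : moment μ (C c * f) = c * moment μ f := by
  simp only [moment, value_mul, value_C, mul_assoc, integral_const_mul]

theorem moment_sum (hd : 1 ≤ d) (hμ : -(1 / 2 : ℝ) < μ) {ι : Type*} (s : Finset ι)
    (f : ι → Poly d) : moment μ (∑ i ∈ s, f i) = ∑ i ∈ s, moment μ (f i) := by
  classical
  induction s using Finset.induction_on with
  | empty => simp [moment, value]
  | insert i s hi ih => rw [Finset.sum_insert hi, Finset.sum_insert hi, moment_add hd hμ, ih]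

theorem moment_dilation (hd : 1 ≤ d) (hμ : -(1 / 2 : ℝ) < μ) (f : Poly d) :
    moment μ (eulerX f + X (Sum.inr ()) * dt f + (C (2 * μ + d) - X (Sum.inr ())) * f) = 0 := by
  have h := (coneFlow_dilation d).moment_mkDerivation hd hμ f
  have hsplit : eulerX f + X (Sum.inr ()) * dt f + (C (2 * μ + d) - X (Sum.inr ())) * f
      = (mkDerivation ℝ X f - X (Sum.inr ()) * f) + C (2 * μ + d) * f := by
    rw [mkDerivation_eq_sum, sum_coordinates]
    simp only [eulerX, dx, dt]
    ring
  rw [hsplit, moment_add hd hμ, h, moment_C_mul]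
  ring

theorem moment_boost (hd : 1 ≤ d) (hμ : -(1 / 2 : ℝ) < μ) (i : Fin d) (f : Poly d) :
    moment μ (X (Sum.inr ()) * dx i f + X (Sum.inl i) * dt f - X (Sum.inl i) * f) = 0 := by
  have h := (coneFlow_boost i).moment_mkDerivation hd hμ f
  rw [mkDerivation_eq_sum, sum_coordinates, Finset.sum_eq_single i] at h
  · simpa [boostField, dx, dt] using h
  · intro j _ hj
    simp [boostField, hj]
  · simp

/-! ### Symmetry and positivity -/

/-- The symmetric bilinear form `⟨A ∇u, ∇v⟩`, where `A = [[t I, x], [xᵀ, t]]` is the matrix of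
the leading coefficients of `coneOp`. -/
def gradForm (u v : Poly d) : Poly d :=
  X (Sum.inr ()) * (dt u * dt v) + ∑ i : Fin d, (X (Sum.inl i) * (dx i v * dt u + dx i u * dt v)
    + X (Sum.inr ()) * (dx i u * dx i v))

theorem gradForm_comm (u v : Poly d) : gradForm u v = gradForm v u := by
  rw [gradForm, gradForm, mul_comm (dt u)]
  exact congrArg _ (Finset.sum_congr rfl fun i _ => by ring)

/-- The divergence form of the operator: the column of `t` in `A` is the field of the
dilations and the column of `x_i` is the field of a boost. -/
theorem coneOp_mul_add_gradForm (μ : ℝ) (u v : Poly d) :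
    coneOp μ u * v + gradForm u v
      = (eulerX (dt u * v) + X (Sum.inr ()) * dt (dt u * v)
          + (C (2 * μ + d) - X (Sum.inr ())) * (dt u * v))
        + ∑ i : Fin d, (X (Sum.inr ()) * dx i (dx i u * v) + X (Sum.inl i) * dt (dx i u * v)
          - X (Sum.inl i) * (dx i u * v)) := by
  have hdx : ∀ (i : Fin d) (f g : Poly d), dx i (f * g) = dx i f * g + f * dx i g :=
    fun i f g => pderiv_mul
  have hdt : ∀ f g : Poly d, dt (f * g) = dt f * g + f * dt g := fun f g => pderiv_mul
  have hcomm : ∀ i : Fin d, dt (dx i u) = dx i (dt u) := fun i => pderiv_pderiv_comm _ _ _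
  simp only [coneOp, gradForm, laplaceX, eulerX, hdx, hdt, hcomm]
  -- Both sides agree summand by summand once all sums over `i` are merged.
  have hsum : ∀ F G H K L : Fin d → Poly d,
      (∀ i, K i + L i
        = X (Sum.inr ()) * F i * v + 2 * G i * v - H i * v
          + (X (Sum.inl i) * (dx i v * dt u + dx i u * dt v)
            + X (Sum.inr ()) * (dx i u * dx i v))) →
      (∑ i, K i) + ∑ i, L i
        = X (Sum.inr ()) * (∑ i, F i) * v + 2 * (∑ i, G i) * v - (∑ i, H i) * v
          + ∑ i, (X (Sum.inl i) * (dx i v * dt u + dx i u * dt v)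
            + X (Sum.inr ()) * (dx i u * dx i v)) := by
    intro F G H K L h
    rw [← Finset.sum_add_distrib, Finset.sum_congr rfl fun i _ => h i, Finset.sum_add_distrib,
      Finset.sum_sub_distrib, Finset.sum_add_distrib]
    simp only [Finset.mul_sum, Finset.sum_mul]
  have h := hsum (fun i => dx i (dx i u)) (fun i => X (Sum.inl i) * dx i (dt u))
    (fun i => X (Sum.inl i) * dx i u)
    (fun i => X (Sum.inl i) * (dx i (dt u) * v + dt u * dx i v))
    (fun i => X (Sum.inr ()) * (dx i (dx i u) * v + dx i u * dx i v)
      + X (Sum.inl i) * (dx i (dt u) * v + dx i u * dt v) - X (Sum.inl i) * (dx i u * v))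
    (fun i => by ring)
  linear_combination -h

theorem moment_coneOp_mul (hd : 1 ≤ d) (hμ : -(1 / 2 : ℝ) < μ) (u v : Poly d) :
    moment μ (coneOp μ u * v) = -moment μ (gradForm u v) := by
  rw [eq_neg_iff_add_eq_zero, ← moment_add hd hμ, coneOp_mul_add_gradForm, moment_add hd hμ,
    moment_dilation hd hμ, zero_add, moment_sum hd hμ]
  exact Finset.sum_eq_zero fun i _ => moment_boost hd hμ i _

/-- The operator is symmetric with respect to the weight. -/
theorem moment_coneOp_mul_comm (hd : 1 ≤ d) (hμ : -(1 / 2 : ℝ) < μ) (u v : Poly d) :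
    moment μ (coneOp μ u * v) = moment μ (u * coneOp μ v) := by
  rw [moment_coneOp_mul hd hμ, gradForm_comm, ← moment_coneOp_mul hd hμ, mul_comm]

/-- The form `∫ f² W` is positive definite: the weight is positive in the interior of the cone,
and a polynomial vanishing there is zero. -/
theorem eq_zero_of_moment_mul_self (hd : 1 ≤ d) (hμ : -(1 / 2 : ℝ) < μ) {f : Poly d}
    (hf : moment μ (f * f) = 0) : f = 0 := by
  have hnonneg : ∀ p ∈ cone d, 0 ≤ value (f * f) p * weight μ p := fun p hp =>
    mul_nonneg (value_mul f f p ▸ mul_self_nonneg _) (weight_nonneg μ hp)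
  have hae := (setIntegral_eq_zero_iff_of_nonneg_ae
    ((ae_restrict_iff' (measurableSet_cone d)).2 (.of_forall hnonneg))
    (integrableOn_value_mul_weight hd hμ (f * f))).1 hf
  let U : Set (Point d) := {p | ‖p.1‖ < p.2}
  have hU : IsOpen U := isOpen_lt (by fun_prop) (by fun_prop)
  have hUcone : U ⊆ cone d := fun p hp => ⟨le_of_lt hp, (norm_nonneg _).trans_lt hp⟩
  have hzero : ∀ᵐ p ∂volume.restrict U, value f p = 0 := by
    have h1 := ae_restrict_of_ae_restrict_of_subset hUcone hae
    filter_upwards [h1, ae_restrict_mem hU.measurableSet] with p hp hpU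
    have hw : 0 < weight μ p := by
      refine mul_pos (Real.rpow_pos_of_pos (sub_pos.2 ?_) _) (Real.exp_pos _)
      exact pow_lt_pow_left₀ hpU (norm_nonneg _) two_ne_zero
    simpa [value_mul, hw.ne'] using hp
  have hUzero : ∀ p ∈ U, value f p = 0 :=
    Measure.eqOn_open_of_ae_eq hzero hU (continuous_value f).continuousOn continuousOn_const
  -- The open cone contains the box `x ∈ (0, 1)^d`, `t > d + 1`.
  refine funext_set (Sum.elim (fun _ => Ioo (0 : ℝ) 1) fun _ => Ioi ((d : ℝ) + 1)) ?_ ?_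
  · rintro (i | _)
    · exact Ioo_infinite one_pos
    · exact Ioi_infinite _
  intro y hy
  let p : Point d := (WithLp.toLp 2 fun i => y (Sum.inl i), y (Sum.inr ()))
  have hp : p ∈ U := by
    have ht : (d : ℝ) + 1 < y (Sum.inr ()) := hy (Sum.inr ()) (mem_univ _)
    have hx : ‖p.1‖ ^ 2 ≤ d := by
      rw [EuclideanSpace.real_norm_sq_eq]
      calc ∑ i, p.1 i ^ 2 ≤ ∑ _i : Fin d, (1 : ℝ) := by
            refine Finset.sum_le_sum fun i _ => ?_
            have hi : y (Sum.inl i) ∈ Ioo (0 : ℝ) 1 := hy (Sum.inl i) (mem_univ _)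
            exact pow_le_one₀ hi.1.le hi.2.le
        _ = d := by simp
    have hd0 : (0 : ℝ) ≤ d := Nat.cast_nonneg d
    change ‖p.1‖ < y (Sum.inr ())
    nlinarith [norm_nonneg p.1]
  have hval : eval y f = value f p := by
    unfold value
    congr 2
    funext j
    rcases j with i | _ <;> rfl
  rw [hval, hUzero p hp, map_zero]

end Moment

/-! ### Degrees -/

theorem totalDegree_pderiv_lt {σ : Type*} {i : σ} {f : MvPolynomial σ ℝ}
    (h : pderiv i f ≠ 0) : (pderiv i f).totalDegree < f.totalDegree := by
  have key : ∀ m ∈ (pderiv i f).support, (m.sum fun _ e => e) < f.totalDegree := by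
    intro m hm
    rw [mem_support_iff, coeff_pderiv] at hm
    have h1 := le_totalDegree (mem_support_iff.2 (left_ne_zero_of_mul hm))
    rw [Finsupp.sum_add_index' (fun _ => rfl) (fun _ _ _ => rfl),
      Finsupp.sum_single_index rfl] at h1
    omega
  obtain ⟨m, hm⟩ := support_nonempty.2 h
  exact (Finset.sup_lt_iff ((Nat.zero_le _).trans_lt (key m hm))).2 key

theorem totalDegree_X_mul_pderiv_le {σ : Type*} (i j : σ) (f : MvPolynomial σ ℝ) :
    (X j * pderiv i f).totalDegree ≤ f.totalDegree := by
  by_cases h : pderiv i f = 0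
  · simp [h]
  · have h1 := totalDegree_mul (X j) (pderiv i f)
    rw [totalDegree_X] at h1
    have h2 := totalDegree_pderiv_lt h
    omega

theorem totalDegree_pderiv_le {σ : Type*} (i : σ) {f : MvPolynomial σ ℝ} {n : ℕ}
    (hf : f.totalDegree ≤ n) : (pderiv i f).totalDegree ≤ n - 1 := by
  by_cases h : pderiv i f = 0
  · simp [h]
  · have := totalDegree_pderiv_lt h
    omega

/-- The Euler operator acts on the part of degree `n` as multiplication by `n`. -/
theorem totalDegree_euler_sub_le {σ : Type*} [Fintype σ] {f : MvPolynomial σ ℝ} {n : ℕ}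
    (hf : f.totalDegree ≤ n) :
    (∑ j, X j * pderiv j f - C (n : ℝ) * f).totalDegree ≤ n - 1 := by
  have hdecomp : ∑ j, X j * pderiv j f - C (n : ℝ) * f
      = ∑ k ∈ Finset.range (f.totalDegree + 1),
        C ((k : ℝ) - n) * homogeneousComponent k f := by
    conv_lhs => rw [← sum_homogeneousComponent f]
    simp only [map_sum, Finset.mul_sum]
    rw [Finset.sum_comm, ← Finset.sum_sub_distrib]
    refine Finset.sum_congr rfl fun k _ => ?_
    rw [(homogeneousComponent_isHomogeneous k f).sum_X_mul_pderiv, C_sub, sub_mul, nsmul_eq_mul]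
    simp
  rw [hdecomp]
  refine totalDegree_finsetSum_le fun k hk => ?_
  rw [Finset.mem_range] at hk
  rcases eq_or_ne k n with rfl | hkn
  · simp
  · refine (totalDegree_mul _ _).trans ?_
    rw [totalDegree_C]
    have := (homogeneousComponent_isHomogeneous k f).totalDegree_le
    omega

/-- On polynomials of degree at most `n` the operator is `-n` up to terms of lower degree: all
summands other than `-⟨x, ∇_x⟩ - t ∂_t` lower the degree. -/
theorem totalDegree_coneOp_add_le (μ : ℝ) {u : Poly d} {n : ℕ} (hu : u.totalDegree ≤ n) :
    (coneOp μ u + C (n : ℝ) * u).totalDegree ≤ n - 1 := by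
  have hsplit : coneOp μ u + C (n : ℝ) * u
      = (∑ i : Fin d, X (Sum.inr ()) * pderiv (Sum.inl i) (dx i u))
        + X (Sum.inr ()) * pderiv (Sum.inr ()) (dt u)
        + C 2 * (∑ i : Fin d, X (Sum.inl i) * pderiv (Sum.inl i) (dt u))
        + C (2 * μ + d) * dt u
        - (∑ j, X j * pderiv j u - C (n : ℝ) * u) := by
    rw [sum_coordinates, ← Finset.mul_sum,
      show (C 2 : Poly d) = 2 from map_ofNat C 2]
    simp only [coneOp, laplaceX, eulerX, dx, dt]
    ring
  have hdx : ∀ i : Fin d, (dx i u).totalDegree ≤ n - 1 := fun i => totalDegree_pderiv_le _ hu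
  have hdt : (dt u).totalDegree ≤ n - 1 := totalDegree_pderiv_le _ hu
  have hC : ∀ (c : ℝ) {f : Poly d}, f.totalDegree ≤ n - 1 → (C c * f).totalDegree ≤ n - 1 :=
    fun c f hf => (totalDegree_mul _ _).trans (by rwa [totalDegree_C, zero_add])
  rw [hsplit]
  refine (totalDegree_sub _ _).trans (max_le ?_ (totalDegree_euler_sub_le hu))
  refine (totalDegree_add _ _).trans (max_le ?_ (hC _ hdt))
  refine (totalDegree_add _ _).trans (max_le ?_ (hC _ ?_))
  · refine (totalDegree_add _ _).trans (max_le ?_ ((totalDegree_X_mul_pderiv_le _ _ _).trans hdt))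
    exact totalDegree_finsetSum_le fun i _ => (totalDegree_X_mul_pderiv_le _ _ _).trans (hdx i)
  · exact totalDegree_finsetSum_le fun i _ => (totalDegree_X_mul_pderiv_le _ _ _).trans hdt

theorem totalDegree_coneOp_le (μ : ℝ) (u : Poly d) :
    (coneOp μ u).totalDegree ≤ u.totalDegree := by
  rw [← add_sub_cancel_right (coneOp μ u) (C (u.totalDegree : ℝ) * u)]
  refine (totalDegree_sub _ _).trans (max_le ?_ ?_)
  · exact (totalDegree_coneOp_add_le μ le_rfl).trans (Nat.sub_le _ _)
  · refine (totalDegree_mul _ _).trans ?_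
    rw [totalDegree_C, zero_add]

/-! ### The differential equation -/

theorem innerProd_eq (μ : ℝ) (f g : Poly d) :
    innerProd μ f g = normConst d μ * moment μ (f * g) := by
  simp only [innerProd, moment, value_mul]

theorem normConst_ne_zero (hd : 1 ≤ d) {μ : ℝ} (hμ : -(1 / 2 : ℝ) < μ) : normConst d μ ≠ 0 := by
  intro h
  have h1 : moment μ ((1 : Poly d) * 1) = 0 := by
    rw [normConst, inv_eq_zero] at h
    simpa [moment, value] using h
  exact one_ne_zero (eq_zero_of_moment_mul_self hd hμ h1)

end LaguerreCone

end

theorem mainTheorem2 (d : ℕ) (hd : 1 ≤ d) (μ : ℝ) (hμ : -(1 / 2 : ℝ) < μ) (n : ℕ)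
    (u : LaguerreCone.Poly d) (hu : u ∈ LaguerreCone.orthPoly d μ n) :
    LaguerreCone.coneOp μ u = -(n : ℝ) • u := by
  open LaguerreCone MvPolynomial in
  obtain ⟨hdeg, horth⟩ := hu
  have hmom : ∀ q : Poly d, q.totalDegree < n → moment μ (u * q) = 0 := fun q hq =>
    (mul_eq_zero.1 (innerProd_eq μ u q ▸ horth q hq)).resolve_left (normConst_ne_zero hd hμ)
  suffices h : coneOp μ u + C (n : ℝ) * u = 0 by
    rw [eq_neg_of_add_eq_zero_left h, neg_smul, smul_eq_C_mul]
  rcases Nat.eq_zero_or_pos n with rfl | hn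
  · rw [totalDegree_eq_zero_iff_eq_C.1 (Nat.le_zero.1 hdeg)]
    simp [coneOp, laplaceX, eulerX, dx, dt]
  -- The remainder has degree less than `n`, and so does its image under the operator; by
  -- symmetry and orthogonality it is then orthogonal to itself.
  set r := coneOp μ u + C (n : ℝ) * u with hr
  have hrdeg : r.totalDegree < n :=
    (totalDegree_coneOp_add_le μ hdeg).trans_lt (Nat.sub_lt hn one_pos)
  refine eq_zero_of_moment_mul_self hd hμ ?_
  have hsplit : r * r = coneOp μ u * r + C (n : ℝ) * (u * r) := by
    nth_rewrite 1 [hr]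
    ring
  rw [hsplit, moment_add hd hμ, moment_C_mul, moment_coneOp_mul_comm hd hμ, hmom r hrdeg,
    hmom _ ((totalDegree_coneOp_le μ r).trans_lt hrdeg), mul_zero, add_zero]
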